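/- Let $V$ be the real vector space of covectors at a point of a manifold of dimension at least $2$, with a fixed positive definite norm $|\cdot|$; let $\Phi$ (field values $\phi^\alpha$, $\dim\Phi=u$) and $\Psi$ (values of the equations, $\dim\Psi=e$) be finite-dimensional complex vector spaces, with a fixed Hermitian inner product $\langle\cdot,\cdot\rangle$ on $\Phi$. Consider the constant-coefficient system $\mathfrak N^{Aa}{}_{\alpha}\nabla_a\phi^\alpha=0$, possibly with more equations than unknowns, and write $N(k)=\mathfrak N^{Aa}{}_{\alpha}k_a:\Phi\to\Psi$ for $k\in V$. Fix a covector $n$, and let $D_n$ be the set of all $k\in V$ with $|k|=1$ that are not proportional to $n$. A constraint is a tensor $c_A{}^a$ with $c_A{}^{(a}\mathfrak N^{|A|b)}{}_{\alpha}=0$, that is, a linear map $c:V\to\Psi'$ with $c(k)N(k)=0$ for all $k\in V$. The system is complete for $n$ if $e=u+\dim\{c_A{}^a n_a : c \text{ a constraint}\}$. For $k\in D_n$ and $\lambda\in\mathbb C$ let $\Phi_R^{\lambda}(k)=\ker\big(N(k)-\lambda N(n)\big)\subseteq\Phi$ and let $\Psi_L^{\lambda}(k)$ be the space of $X\in\Psi'$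 with $X\big(N(k)-\lambda N(n)\big)=0$. Let $\Phi_L^{\lambda}(k)\subseteq\Phi$ be the space of the vectors $w$ for which there is an $X\in\Psi_L^{\lambda}(k)$ with $\langle w,v\rangle=X(N(n)v)$ for all $v\in\Phi$. The number $\lambda$ is a generalized eigenvalue at $k$ if $\Phi_R^{\lambda}(k)\neq0$. The system is hyperbolic in the direction $n$ if $\ker N(n)=0$ and for every $k\in D_n$ all generalized eigenvalues are real. A hyperbolizer in the direction $n$ is a map $h$ from $V$ to the linear maps $\Psi\to\Phi$, with $h(rk)=h(k)$ for $r>0$ (a possibly pseudo-differential reduction of degree $0$; no regularity in $k$ is required), such that $h(k)N(n)$ is invertible for all $k\in D_n$ and the reduced system is strongly hyperbolic in the Kreiss sense: with $A(k)=(h(k)N(n))^{-1}h(k)N(k)$, all eigenvalues of $A(k)$ are real for all $k\in D_n$, and there is a constant $C>0$ such that for every $k\in D_n$ one can write $A(k)=S(k)\Lambda(k)S(k)^{-1}$ with $\Lambda(k)$ diagonal and $\|S(k)\|\,\|S(k)^{-1}\|\le C$. Theorem. Suppose that the system is complete for $n$. Then it admits a hyperbolizer in the direction $n$ if and only if 1.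 it is hyperbolic in the direction $n$, and 2. there is a constant $\vartheta<\pi/2$ such that for all $k\in D_n$ and all generalized eigenvalues $\lambda$ at $k$ all principal angles between $\Phi_L^{\lambda}(k)$ and $\Phi_R^{\lambda}(k)$ are at most $\vartheta$. The "only if" part holds for every $n$ without the assumption that the system is complete. -/

import Mathlib

/-!
First order systems `N^{Aa}_α ∇_a φ^α = 0` with constant complex coefficients.

* `V` is the real vector space of covectors `k_a` (dual to the tangent space of the manifold);
  its norm is the auxiliary positive definite norm used to normalise `k_a`.
* `Φ` is the complex vector space of field values `φ^α`; its inner product is the fixed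
  positive definite Hermitian form `G_{αγ}`.
* `Ψ` is the complex vector space in which the equations take values; covectors `X_A` are the
  elements of `Module.Dual ℂ Ψ`.
* The coefficient tensor is the real-linear map `N : V → (Φ → Ψ)`, `N k = N^{Aa}_α k_a`.
-/

namespace FirstOrderSystem

noncomputable section

section Symbol

variable {V Φ Ψ : Type*} [NormedAddCommGroup V] [NormedSpace ℝ V]
  [NormedAddCommGroup Φ] [InnerProductSpace ℂ Φ]
  [AddCommGroup Ψ] [Module ℂ Ψ]

/-- The covectors `k` of norm one that are not proportional to `n`. -/
def directions (n : V) : Set V :=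
  {k | k ∉ Submodule.span ℝ {n} ∧ ‖k‖ = 1}

/-- The principal symbol `N(l(λ)) = N(k) - λ N(n)` along the complex plane
`l(λ) = -λ n + k`. -/
def symbolAlong (N : V →ₗ[ℝ] Φ →ₗ[ℂ] Ψ) (n k : V) (lam : ℂ) : Φ →ₗ[ℂ] Ψ :=
  N k - lam • N n

/-- The right kernel `Φ_R^λ` of the principal symbol at `l(λ)`. -/
def rightKernel (N : V →ₗ[ℝ] Φ →ₗ[ℂ] Ψ) (n k : V) (lam : ℂ) : Submodule ℂ Φ :=
  LinearMap.ker (symbolAlong N n k lam)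

/-- The left kernel `Ψ_L^λ` of the principal symbol at `l(λ)`: the covectors `X` on the space
of equations with `X ∘ N(l(λ)) = 0`. -/
def leftKernel (N : V →ₗ[ℝ] Φ →ₗ[ℂ] Ψ) (n k : V) (lam : ℂ) :
    Submodule ℂ (Module.Dual ℂ Ψ) :=
  LinearMap.ker (symbolAlong N n k lam).dualMap

/-- The projected left kernel `Φ_L^λ`: every `X` in the left kernel is mapped to the covector
`X ∘ N(n)` on the field space, and its index is raised with the Hermitian form of `Φ`,
i.e. it is replaced by the vector `w` with `⟪w, v⟫ = X (N(n) v)` for all `v`. -/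
def projectedLeftKernel (N : V →ₗ[ℝ] Φ →ₗ[ℂ] Ψ) (n k : V) (lam : ℂ) : Submodule ℂ Φ where
  carrier := {w | ∃ X ∈ leftKernel N n k lam, ∀ v : Φ, inner ℂ w v = X (N n v)}
  zero_mem' := ⟨0, Submodule.zero_mem _, fun v => by simp⟩
  add_mem' := by
    rintro a b ⟨X, hX, hXa⟩ ⟨Y, hY, hYb⟩
    exact ⟨X + Y, Submodule.add_mem _ hX hY, fun v => by
      rw [inner_add_left, hXa, hYb, LinearMap.add_apply]⟩
  smul_mem' := by
    rintro c a ⟨X, hX, hXa⟩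
    exact ⟨(starRingEnd ℂ) c • X, Submodule.smul_mem _ _ hX, fun v => by
      rw [inner_smul_left, hXa, LinearMap.smul_apply, smul_eq_mul]⟩

/-- `lam` is a generalized eigenvalue of the system for `(n, k)`: the principal symbol at `l(λ)`
has a non-trivial right kernel. -/
def IsGeneralizedEigenvalue (N : V →ₗ[ℝ] Φ →ₗ[ℂ] Ψ) (n k : V) (lam : ℂ) : Prop :=
  rightKernel N n k lam ≠ ⊥

/-- The system is hyperbolic in the direction `n`: `N(n)` has no right kernel, and all
generalized eigenvalues are real. -/
def IsHyperbolic (N : V →ₗ[ℝ] Φ →ₗ[ℂ] Ψ) (n : V) : Prop :=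
  LinearMap.ker (N n) = ⊥ ∧
    ∀ k ∈ directions n, ∀ lam : ℂ, IsGeneralizedEigenvalue N n k lam → lam.im = 0

/-- A constraint of the system: a tensor `c_A^a` with `c_A^{(a} N^{|A|b)}_α = 0`, that is, a
linear map `c` with `c(k) N(k) = 0` for all covectors `k`. -/
def IsConstraint (N : V →ₗ[ℝ] Φ →ₗ[ℂ] Ψ) (c : V →ₗ[ℝ] Module.Dual ℂ Ψ) : Prop :=
  ∀ k : V, c k ∘ₗ N k = 0

/-- The linear combinations `c_A^a n_a` of the equations that are given by constraints `c` (they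
contain no derivative transversal to the surfaces with conormal `n`). -/
def constraintCombinations (N : V →ₗ[ℝ] Φ →ₗ[ℂ] Ψ) (n : V) :
    Submodule ℂ (Module.Dual ℂ Ψ) where
  carrier := {X | ∃ c : V →ₗ[ℝ] Module.Dual ℂ Ψ, IsConstraint N c ∧ c n = X}
  zero_mem' := ⟨0, fun k => by simp, by simp⟩
  add_mem' := by
    rintro X Y ⟨c, hc, rfl⟩ ⟨d, hd, rfl⟩
    exact ⟨c + d, fun k => by rw [LinearMap.add_apply, LinearMap.add_comp, hc, hd, add_zero],
      by simp⟩
  smul_mem' := by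
    rintro z X ⟨c, hc, rfl⟩
    exact ⟨z • c, fun k => by rw [LinearMap.smul_apply, LinearMap.smul_comp, hc, smul_zero],
      by simp⟩

/-- The system is complete for `n`: the number of equations is the number of fields plus the
number of constraints, `e = u + c`. -/
def IsComplete (N : V →ₗ[ℝ] Φ →ₗ[ℂ] Ψ) (n : V) : Prop :=
  Module.finrank ℂ Ψ = Module.finrank ℂ Φ + Module.finrank ℂ (constraintCombinations N n)

end Symbol

section Angles

variable {Φ : Type*} [NormedAddCommGroup Φ] [InnerProductSpace ℂ Φ] [FiniteDimensional ℂ Φ]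

/-- The principal angles between two subspaces `L` and `R`, indexed by
`j < min (dim L) (dim R)`: their cosines are the singular values of the matrix of inner products
of orthonormal bases of `L` and `R`, i.e. of the orthogonal projection to `L` restricted
to `R`. -/
def principalAngle (L R : Submodule ℂ Φ) (j : ℕ) : ℝ :=
  Real.arccos
    ((L.orthogonalProjectionOnto.toLinearMap ∘ₗ R.subtype : R →ₗ[ℂ] L).singularValues j)

end Angles

section Reduction

variable {V Φ Ψ : Type*} [NormedAddCommGroup V] [NormedSpace ℝ V]
  [NormedAddCommGroup Φ] [InnerProductSpace ℂ Φ] [FiniteDimensional ℂ Φ]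
  [AddCommGroup Ψ] [Module ℂ Ψ]

/-- Uniform bound on the angles: a constant `ϑ < π / 2` bounds all the angles between the
projected left kernel and the right kernel, at all generalized eigenvalues, for all unit `k` not
proportional to `n`. -/
def HasUniformAngleBound (N : V →ₗ[ℝ] Φ →ₗ[ℂ] Ψ) (n : V) : Prop :=
  ∃ ϑ : ℝ, ϑ < Real.pi / 2 ∧
    ∀ k ∈ directions n, ∀ lam : ℂ, IsGeneralizedEigenvalue N n k lam →
      ∀ j < min (Module.finrank ℂ (projectedLeftKernel N n k lam))
          (Module.finrank ℂ (rightKernel N n k lam)),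
        principalAngle (projectedLeftKernel N n k lam) (rightKernel N n k lam) j ≤ ϑ

/-- The matrix `A(k) = (h(k) N(n))⁻¹ h(k) N(k)` of the reduced system
`h(k) N(n) ∂_t φ + i h(k) N(k) φ = 0`. It is used only where `h(k) N(n)` is invertible. -/
def evolutionMatrix (N : V →ₗ[ℝ] Φ →ₗ[ℂ] Ψ) (n : V) (h : V → (Ψ →ₗ[ℂ] Φ)) (k : V) :
    Module.End ℂ Φ :=
  Ring.inverse (h k ∘ₗ N n : Module.End ℂ Φ) * (h k ∘ₗ N k : Module.End ℂ Φ)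

/-- Multiplication by the diagonal matrix with entries `d`. -/
def diagonalMap {u : ℕ} (d : Fin u → ℂ) :
    EuclideanSpace ℂ (Fin u) →ₗ[ℂ] EuclideanSpace ℂ (Fin u) :=
  Matrix.toEuclideanLin (Matrix.diagonal d)

/-- Strong hyperbolicity of an evolution system `∂_t φ + i A(k) φ = 0` in the sense of Kreiss:
for `k` in the set `D` of directions all eigenvalues of `A(k)` are real, and `A(k)` is uniformly
diagonalizable, `A(k) = S(k) Λ(k) S(k)⁻¹` with `‖S(k)‖ ‖S(k)⁻¹‖ ≤ C`, where `C` does not depend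
on `k`. -/
def IsStronglyHyperbolic (D : Set V) (A : V → Module.End ℂ Φ) : Prop :=
  (∀ k ∈ D, ∀ τ : ℂ, (A k).HasEigenvalue τ → τ.im = 0) ∧
    ∃ C : ℝ, 0 < C ∧ ∀ k ∈ D,
      ∃ (S : EuclideanSpace ℂ (Fin (Module.finrank ℂ Φ)) ≃L[ℂ] Φ)
        (d : Fin (Module.finrank ℂ Φ) → ℂ),
        (∀ v : Φ, A k v = S (diagonalMap d (S.symm v))) ∧
          ‖(S : EuclideanSpace ℂ (Fin (Module.finrank ℂ Φ)) →L[ℂ] Φ)‖ *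
            ‖(S.symm : Φ →L[ℂ] EuclideanSpace ℂ (Fin (Module.finrank ℂ Φ)))‖ ≤ C

/-- `h` is a hyperbolizer in the direction `n`: a reduction, given by a symbol `h(k)` homogeneous
of degree zero in `k`, for which `h(k) N(n)` is invertible and the reduced system is strongly
hyperbolic. -/
structure IsHyperbolizer (N : V →ₗ[ℝ] Φ →ₗ[ℂ] Ψ) (n : V) (h : V → (Ψ →ₗ[ℂ] Φ)) : Prop where
  homogeneous : ∀ (r : ℝ) (k : V), 0 < r → h (r • k) = h k
  invertible : ∀ k ∈ directions n, IsUnit (h k ∘ₗ N n : Module.End ℂ Φ)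
  stronglyHyperbolic : IsStronglyHyperbolic (directions n) (evolutionMatrix N n h)

/-- The system admits a hyperbolizer in the direction `n`. -/
def AdmitsHyperbolizer (N : V →ₗ[ℝ] Φ →ₗ[ℂ] Ψ) (n : V) : Prop :=
  ∃ h : V → (Ψ →ₗ[ℂ] Φ), IsHyperbolizer N n h

end Reduction

end

end FirstOrderSystem

/-! Necessity. A hyperbolizer gives A(k), which acts as λ on the right kernel of λ. Let P be the
projection onto the λ-eigenspace of A(k) along the others; the diagonalization bounds it by C. For v
in the right kernel, w = P*v lies in the projected left kernel, ⟪w, v⟫ = ‖v‖² and ‖w‖ ≤ C‖v‖. So the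
orthogonal projection of v to that space has norm at least ‖v‖ / C: the cosines of the angles are at
least 1 / C (`IsHyperbolizer.norm_le_mul_norm_orthogonalProjectionOnto`).

Sufficiency. Let F be the space of fields φ with N(k)φ in the range of N(n). Completeness makes F
invariant under B = N(n)⁻¹N(k) (`IsComplete.mem_determinedFields`), and the eigenspaces of B are the
right kernels. Choose a left inverse g of N(n) that kills N(k)Fᗮ; then gN(k) is B on F and 0 on Fᗮ.
If z = (B - μ)x is an eigenvector for μ, it is orthogonal to the projected left kernel, so the angle
bound forces z = 0: there are no Jordan blocks (`iSup_reducedEigenspace_eq_top`). The projected left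
kernel of μ is orthogonal to all other right kernels, so the same bound separates the eigenspaces
uniformly in k (`reducedEigenspace_separated`), which bounds the condition number. -/

open Module

/-! ### Singular values as lower bounds for a linear map. -/

section SingularValues

variable {E F : Type*} [NormedAddCommGroup E] [InnerProductSpace ℂ E] [FiniteDimensional ℂ E]
  [NormedAddCommGroup F] [InnerProductSpace ℂ F] [FiniteDimensional ℂ F]

/-- The square of `‖T v‖` in terms of the squared singular values of `T`. -/
theorem LinearMap.norm_apply_sq_eq_sum_singularValues (T : E →ₗ[ℂ] F) (v : E) :
    ‖T v‖ ^ 2 = ∑ i : Fin (finrank ℂ E), T.singularValues i ^ 2 *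
      ‖(T.isSymmetric_adjoint_comp_self.eigenvectorBasis rfl).repr v i‖ ^ 2 := by
  set b := T.isSymmetric_adjoint_comp_self.eigenvectorBasis rfl with hb
  have h1 : (inner ℂ v ((LinearMap.adjoint T ∘ₗ T) v) : ℂ) = ((‖T v‖ ^ 2 : ℝ) : ℂ) := by
    rw [LinearMap.comp_apply, LinearMap.adjoint_inner_right, inner_self_eq_norm_sq_to_K]
    norm_cast
  have h2 := b.repr.inner_map_map v ((LinearMap.adjoint T ∘ₗ T) v)
  rw [h1, PiLp.inner_apply] at h2
  apply Complex.ofReal_injective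
  rw [← h2, Complex.ofReal_sum]
  refine Finset.sum_congr rfl fun i _ => ?_
  rw [hb, LinearMap.IsSymmetric.eigenvectorBasis_apply_self_apply, ← hb,
    T.sq_singularValues_fin rfl i, RCLike.inner_apply, mul_assoc, RCLike.mul_conj]
  norm_cast

theorem LinearMap.mul_norm_le_of_le_singularValues (T : E →ₗ[ℂ] F) {c : ℝ} (hc : 0 ≤ c)
    (h : ∀ j < finrank ℂ E, c ≤ T.singularValues j) (v : E) : c * ‖v‖ ≤ ‖T v‖ := by
  set b := T.isSymmetric_adjoint_comp_self.eigenvectorBasis rfl with hb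
  refine le_of_sq_le_sq ?_ (norm_nonneg _)
  rw [T.norm_apply_sq_eq_sum_singularValues, ← hb, mul_pow, ← b.repr.norm_map v,
    EuclideanSpace.norm_sq_eq, Finset.mul_sum]
  gcongr with i
  exact h i i.2

/-- The bound is tested on the j-th eigenvector of T*T, which T maps to a vector of norm σ_j. -/
theorem LinearMap.le_singularValues (T : E →ₗ[ℂ] F) {c : ℝ}
    (h : ∀ v, c * ‖v‖ ≤ ‖T v‖) {j : ℕ} (hj : j < finrank ℂ E) : c ≤ T.singularValues j := by
  set b := T.isSymmetric_adjoint_comp_self.eigenvectorBasis rfl with hb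
  have h1 := T.norm_apply_sq_eq_sum_singularValues (b ⟨j, hj⟩)
  rw [← hb, Finset.sum_eq_single ⟨j, hj⟩] at h1
  · have h2 := h (b ⟨j, hj⟩)
    have h3 : ‖T (b ⟨j, hj⟩)‖ = T.singularValues j := by
      rw [← sq_eq_sq₀ (norm_nonneg _) (T.singularValues_nonneg j), h1]
      simp
    simpa [h3] using h2
  · intro i _ hi
    simp [hi]
  · simp

end SingularValues

/-! ### Diagonalization with a bound on the condition number. -/

section Diagonalization

variable {Φ : Type*} [NormedAddCommGroup Φ] [InnerProductSpace ℂ Φ] [FiniteDimensional ℂ Φ]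

/-- The coordinates in a basis adapted to a decomposition, orthonormal in every summand, are
controlled by the separation of the summands. -/
theorem DirectSum.IsInternal.norm_collectedBasis_repr_le {ι : Type*} [DecidableEq ι]
    {E : ι → Submodule ℂ Φ} (hE : DirectSum.IsInternal E) {K : ℝ}
    (hK : ∀ i, ∀ v ∈ E i, ∀ w ∈ ⨆ (j) (_ : j ≠ i), E j, ‖v‖ ≤ K * ‖v + w‖)
    (v : Φ) (a : Σ i, Fin (finrank ℂ (E i))) :
    ‖(hE.collectedBasis fun i => (stdOrthonormalBasis ℂ (E i)).toBasis).repr v a‖ ≤ K * ‖v‖ := by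
  obtain ⟨i, a⟩ := a
  set b := hE.collectedBasis fun i => (stdOrthonormalBasis ℂ (E i)).toBasis with hb
  have htop : E i ⊔ ⨆ (j) (_ : j ≠ i), E j = ⊤ := by
    rw [eq_top_iff, ← hE.submodule_iSup_eq_top]
    refine iSup_le fun j => ?_
    by_cases hj : j = i
    · subst hj; exact le_sup_left
    · exact (le_iSup₂_of_le (f := fun j (_ : j ≠ i) => E j) j hj le_rfl).trans le_sup_right
  obtain ⟨p, hp, w, hw, rfl⟩ := Submodule.mem_sup.1 (htop ▸ Submodule.mem_top : v ∈ _)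
  have hw0 : b.repr w ⟨i, a⟩ = 0 := by
    have hle : (⨆ (j) (_ : j ≠ i), E j) ≤ LinearMap.ker (b.coord ⟨i, a⟩) := by
      refine iSup₂_le fun j hj x hx => ?_
      exact LinearMap.mem_ker.2 (hE.collectedBasis_repr_of_mem_ne
        (fun i => (stdOrthonormalBasis ℂ (E i)).toBasis) hj hx)
    exact hle hw
  rw [map_add, Finsupp.add_apply, hw0, add_zero, hb, hE.collectedBasis_repr_of_mem _ hp,
    OrthonormalBasis.coe_toBasis_repr_apply]
  refine (PiLp.norm_apply_le _ a).trans ?_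
  rw [LinearIsometryEquiv.norm_map]
  exact hK i p hp w hw

omit [FiniteDimensional ℂ Φ] in
/-- A basis of eigenvectors of norm at most one whose coordinate functionals are bounded by `K`
diagonalizes an endomorphism with a bound on the condition number. -/
theorem Module.Basis.exists_diagonalMap_of_eigenvectors {A : Module.End ℂ Φ} {ι : Type*} [Fintype ι]
    (b : Basis ι ℂ Φ) (d : ι → ℂ) {K : ℝ} (hK : 0 ≤ K) (hA : ∀ i, A (b i) = d i • b i)
    (hb : ∀ i, ‖b i‖ ≤ 1) (hrepr : ∀ v i, ‖b.repr v i‖ ≤ K * ‖v‖) :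
    ∃ (S : EuclideanSpace ℂ (Fin (finrank ℂ Φ)) ≃L[ℂ] Φ) (d : Fin (finrank ℂ Φ) → ℂ),
      (∀ v : Φ, A v = S (FirstOrderSystem.diagonalMap d (S.symm v))) ∧
        ‖(S : EuclideanSpace ℂ (Fin (finrank ℂ Φ)) →L[ℂ] Φ)‖ *
          ‖(S.symm : Φ →L[ℂ] EuclideanSpace ℂ (Fin (finrank ℂ Φ)))‖ ≤
            finrank ℂ Φ * (finrank ℂ Φ * K) := by
  let e : ι ≃ Fin (finrank ℂ Φ) := Fintype.equivFinOfCardEq (finrank_eq_card_basis b).symm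
  let b' := b.reindex e
  let S := ((EuclideanSpace.equiv (Fin (finrank ℂ Φ)) ℂ).toLinearEquiv.trans
    b'.equivFun.symm).toContinuousLinearEquiv
  have hS : ∀ x, S x = ∑ i, x i • b' i := fun x => b'.equivFun_symm_apply _
  have hS' : ∀ v i, S.symm v i = b'.repr v i := fun v i => rfl
  refine ⟨S, d ∘ e.symm, fun v => ?_, ?_⟩
  · rw [hS]
    conv_lhs => rw [← b'.sum_repr v, map_sum]
    refine Finset.sum_congr rfl fun i _ => ?_
    have h1 : A (b' i) = d (e.symm i) • b' i := by simp [b', hA]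
    have h2 : FirstOrderSystem.diagonalMap (d ∘ e.symm) (S.symm v) i =
        d (e.symm i) * b'.repr v i := by
      simp [FirstOrderSystem.diagonalMap, Matrix.mulVec_diagonal, hS']
    rw [map_smul, h1, h2, smul_smul, mul_comm]
  · refine mul_le_mul ?_ ?_ (norm_nonneg _) (Nat.cast_nonneg _)
    · refine ContinuousLinearMap.opNorm_le_bound _ (Nat.cast_nonneg _) fun x => ?_
      rw [ContinuousLinearEquiv.coe_coe, hS]
      calc ‖∑ i, x i • b' i‖ ≤ ∑ _i : Fin (finrank ℂ Φ), ‖x‖ := by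
            refine norm_sum_le_of_le _ fun i _ => ?_
            rw [_root_.norm_smul]
            have : ‖b' i‖ ≤ 1 := by simpa [b'] using hb (e.symm i)
            nlinarith [PiLp.norm_apply_le x i, norm_nonneg (x i), norm_nonneg (b' i)]
        _ = _ := by simp
    · refine ContinuousLinearMap.opNorm_le_bound _ (by positivity) fun v => ?_
      rw [ContinuousLinearEquiv.coe_coe]
      have h1 : S.symm v = ∑ i, S.symm v i • EuclideanSpace.single i (1 : ℂ) := by
        ext j
        simp [Finset.sum_apply, Pi.single_apply]
      rw [h1]
      calc _ ≤ ∑ _i : Fin (finrank ℂ Φ), K * ‖v‖ := by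
            refine norm_sum_le_of_le _ fun i _ => ?_
            rw [_root_.norm_smul, hS']
            simpa [b'] using hrepr v (e.symm i)
        _ = _ := by simp [mul_assoc]

/-- An endomorphism that is scalar on every member of a spanning family of uniformly separated
subspaces is diagonalizable, with a bound on the condition number. -/
theorem Module.End.exists_diagonalMap_of_separated {A : Module.End ℂ Φ} {ι : Type*}
    {E : ι → Submodule ℂ Φ} {d : ι → ℂ} {K : ℝ} (hK0 : 0 ≤ K) (htop : ⨆ i, E i = ⊤)
    (hA : ∀ i, ∀ v ∈ E i, A v = d i • v)
    (hK : ∀ i, ∀ v ∈ E i, ∀ w ∈ ⨆ (j) (_ : j ≠ i), E j, ‖v‖ ≤ K * ‖v + w‖) :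
    ∃ (S : EuclideanSpace ℂ (Fin (finrank ℂ Φ)) ≃L[ℂ] Φ) (d : Fin (finrank ℂ Φ) → ℂ),
      (∀ v : Φ, A v = S (FirstOrderSystem.diagonalMap d (S.symm v))) ∧
        ‖(S : EuclideanSpace ℂ (Fin (finrank ℂ Φ)) →L[ℂ] Φ)‖ *
          ‖(S.symm : Φ →L[ℂ] EuclideanSpace ℂ (Fin (finrank ℂ Φ)))‖ ≤
            finrank ℂ Φ * (finrank ℂ Φ * K) := by
  classical
  have hind : iSupIndep E := by
    -- Independence is the separation estimate with w = -x.
    refine fun i => Submodule.disjoint_def.2 fun x hx hx' => ?_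
    simpa using hK i x hx (-x) (Submodule.neg_mem _ hx')
  have hE := DirectSum.isInternal_submodule_of_iSupIndep_of_iSup_eq_top hind htop
  let b := hE.collectedBasis fun i => (stdOrthonormalBasis ℂ (E i)).toBasis
  -- There may be infinitely many summands, but all except finitely many are zero, so the collected
  -- basis is finite.
  have : Fintype (Σ i, Fin (finrank ℂ (E i))) := FiniteDimensional.fintypeBasisIndex b
  refine b.exists_diagonalMap_of_eigenvectors (fun a => d a.1) hK0
    (fun a => hA a.1 _ (hE.collectedBasis_mem _ a)) (fun a => ?_)
    (fun v a => hE.norm_collectedBasis_repr_le hK v a)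
  rw [hE.collectedBasis_coe]
  simp only [OrthonormalBasis.coe_toBasis]
  exact ((stdOrthonormalBasis ℂ (E a.1)).norm_eq_one a.2).le

/-- If no generalized eigenvector of order two exists, the eigenspaces span. -/
theorem Module.End.iSup_eigenspace_eq_top_of_apply_apply (A : Module.End ℂ Φ)
    (h : ∀ (μ : ℂ) (v : Φ), A (A v - μ • v) = μ • (A v - μ • v) → A v = μ • v) :
    ⨆ μ, A.eigenspace μ = ⊤ := by
  rw [eq_top_iff, ← A.iSup_maxGenEigenspace_eq_top]
  refine iSup_mono fun μ v hv => ?_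
  obtain ⟨m, hm⟩ := (A.mem_maxGenEigenspace μ v).1 hv
  rw [Module.End.mem_eigenspace_iff]
  induction m with
  | zero =>
    obtain rfl : v = 0 := by simpa using hm
    simp
  | succ m ih =>
    cases m with
    | zero => simpa [sub_eq_zero] using hm
    | succ m =>
      refine ih ?_
      rw [pow_succ', pow_succ', Module.End.mul_apply, Module.End.mul_apply] at hm
      rw [pow_succ', Module.End.mul_apply]
      -- The hypothesis, applied to (A - μ)^m v, lowers the nilpotency exponent from m + 2 to m + 1.
      have := h μ (((A - μ • 1) ^ m) v) (by simpa [sub_eq_zero] using hm)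
      simpa [sub_eq_zero] using this

end Diagonalization

namespace FirstOrderSystem

variable {V Φ Ψ : Type*} [NormedAddCommGroup V] [NormedSpace ℝ V]
  [NormedAddCommGroup Φ] [InnerProductSpace ℂ Φ]
  [AddCommGroup Ψ] [Module ℂ Ψ]

/-! ### Duality between left and right kernels. -/

section Kernels

theorem mem_rightKernel_iff {N : V →ₗ[ℝ] Φ →ₗ[ℂ] Ψ} {n k : V} {lam : ℂ} {v : Φ} :
    v ∈ rightKernel N n k lam ↔ N k v = lam • N n v := by
  simp [rightKernel, symbolAlong, sub_eq_zero]

theorem mem_leftKernel_iff {N : V →ₗ[ℝ] Φ →ₗ[ℂ] Ψ} {n k : V} {lam : ℂ} {X : Dual ℂ Ψ} :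
    X ∈ leftKernel N n k lam ↔ ∀ v, X (N k v) = lam * X (N n v) := by
  simp [leftKernel, symbolAlong, LinearMap.ext_iff, sub_eq_zero]

/-- This is where dimension at least two enters: injectivity of N(n) is read off from h(k)N(n) at
some direction k. -/
theorem directions_nonempty (hV : 2 ≤ finrank ℝ V) (n : V) : (directions n).Nonempty := by
  have hlt : Submodule.span ℝ {n} < ⊤ := by
    refine lt_top_iff_ne_top.2 fun h => ?_
    have h1 := finrank_span_le_card (R := ℝ) ({n} : Set V)
    rw [h, finrank_top] at h1
    simp at h1
    omega
  obtain ⟨x, -, hx⟩ := SetLike.exists_of_lt hlt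
  have hx0 : x ≠ 0 := fun h => hx (h ▸ Submodule.zero_mem _)
  refine ⟨‖x‖⁻¹ • x, fun h => hx ?_, norm_smul_inv_norm hx0⟩
  exact (Submodule.smul_mem_iff _ (inv_ne_zero (norm_ne_zero_iff.2 hx0))).1 h

/-- Covectors separate a point from a subspace. -/
theorem mem_of_forall_dual {W : Submodule ℂ Ψ} {y : Ψ}
    (h : ∀ X : Dual ℂ Ψ, (∀ x ∈ W, X x = 0) → X y = 0) : y ∈ W := by
  by_contra hy
  obtain ⟨X, hX, hXW⟩ := Submodule.exists_dual_map_eq_bot_of_notMem hy inferInstance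
  exact hX (h X fun x hx => (Submodule.mem_bot ℂ).1 (hXW ▸ Submodule.mem_map_of_mem hx))

/-- A vector whose image under `N(n)` lies in the range of the symbol is orthogonal to the
projected left kernel. -/
theorem mem_orthogonal_of_apply_eq {N : V →ₗ[ℝ] Φ →ₗ[ℂ] Ψ} {n k : V} {lam : ℂ} {v u : Φ}
    (hv : N n v = N k u - lam • N n u) : v ∈ (projectedLeftKernel N n k lam)ᗮ := by
  rintro w ⟨X, hX, hw⟩
  rw [hw, hv, map_sub, map_smul, mem_leftKernel_iff.1 hX, smul_eq_mul, sub_self]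

/-- The projected left kernels annihilate the right kernels of the other eigenvalues. -/
theorem rightKernel_le_orthogonal {N : V →ₗ[ℝ] Φ →ₗ[ℂ] Ψ} {n k : V} {lam mu : ℂ} (h : mu ≠ lam) :
    rightKernel N n k mu ≤ (projectedLeftKernel N n k lam)ᗮ := by
  intro v hv
  refine mem_orthogonal_of_apply_eq (u := (mu - lam)⁻¹ • v) ?_
  rw [map_smul, map_smul, mem_rightKernel_iff.1 hv, smul_comm lam, ← smul_sub, ← sub_smul,
    inv_smul_smul₀ (sub_ne_zero.2 h)]

variable [FiniteDimensional ℂ Φ]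

/-- Raising the index of `X ∘ N(n)`. -/
theorem exists_mem_projectedLeftKernel {N : V →ₗ[ℝ] Φ →ₗ[ℂ] Ψ} {n k : V} {lam : ℂ}
    {X : Dual ℂ Ψ} (hX : X ∈ leftKernel N n k lam) :
    ∃ w ∈ projectedLeftKernel N n k lam, ∀ v, inner ℂ w v = X (N n v) := by
  have hw : ∀ v, inner ℂ ((InnerProductSpace.toDual ℂ Φ).symm
      (LinearMap.toContinuousLinearMap (X ∘ₗ N n))) v = X (N n v) := fun v => by
    rw [InnerProductSpace.toDual_symm_apply]; rfl
  exact ⟨_, ⟨X, hX, hw⟩, hw⟩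

/-- Converse of `mem_orthogonal_of_apply_eq`: the range of the symbol is the common kernel of the
covectors in the left kernel. -/
theorem apply_mem_range_of_mem_orthogonal {N : V →ₗ[ℝ] Φ →ₗ[ℂ] Ψ} {n k : V} {lam : ℂ} {v : Φ}
    (hv : v ∈ (projectedLeftKernel N n k lam)ᗮ) :
    N n v ∈ LinearMap.range (symbolAlong N n k lam) := by
  refine mem_of_forall_dual fun X hX => ?_
  obtain ⟨w, hw, hwX⟩ := exists_mem_projectedLeftKernel (N := N) (n := n) (k := k) (lam := lam)
    (X := X) (LinearMap.mem_ker.2 (LinearMap.ext fun x => hX _ ⟨x, rfl⟩))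
  rw [← hwX]
  exact hv w hw

/-- N(n) embeds the orthogonal complement of the projected left kernel in the range of the symbol;
rank-nullity does the rest. Consequently there are as many principal angles as dimensions of the
right kernel, and bounding them controls every vector in it. -/
theorem finrank_rightKernel_le [FiniteDimensional ℂ Ψ] {N : V →ₗ[ℝ] Φ →ₗ[ℂ] Ψ} {n k : V}
    (hn : LinearMap.ker (N n) = ⊥) (lam : ℂ) :
    finrank ℂ (rightKernel N n k lam) ≤ finrank ℂ (projectedLeftKernel N n k lam) := by
  have h1 : finrank ℂ (projectedLeftKernel N n k lam)ᗮ ≤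
      finrank ℂ (LinearMap.range (symbolAlong N n k lam)) := by
    refine LinearMap.finrank_le_finrank_of_injective
      (f := (N n).restrict fun v hv => apply_mem_range_of_mem_orthogonal hv) ?_
    intro x y hxy
    exact Subtype.ext (LinearMap.ker_eq_bot.1 hn (congrArg Subtype.val hxy))
  have h2 := (symbolAlong N n k lam).finrank_range_add_finrank_ker
  have h3 := (projectedLeftKernel N n k lam).finrank_add_finrank_orthogonal
  rw [rightKernel]
  omega

end Kernels

/-! ### Principal angles and orthogonal projections. -/

section Angles

variable [FiniteDimensional ℂ Φ]

/-- Bounds on the principal angles in terms of the orthogonal projection. -/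
theorem mul_norm_le_of_principalAngle_le {L R : Submodule ℂ Φ} {ϑ : ℝ} (h0 : 0 ≤ ϑ)
    (h1 : ϑ < Real.pi / 2) (h : ∀ j < finrank ℂ R, principalAngle L R j ≤ ϑ) {v : Φ}
    (hv : v ∈ R) : Real.cos ϑ * ‖v‖ ≤ ‖L.orthogonalProjectionOnto v‖ := by
  refine LinearMap.mul_norm_le_of_le_singularValues
    (L.orthogonalProjectionOnto.toLinearMap ∘ₗ R.subtype : R →ₗ[ℂ] L)
    (Real.cos_nonneg_of_mem_Icc ⟨by linarith, h1.le⟩) (fun j hj => ?_) ⟨v, hv⟩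
  have := h j hj
  rw [principalAngle] at this
  by_contra! hlt
  have h2 := Real.arccos_lt_arccos (LinearMap.singularValues_nonneg _ j |>.trans' (by norm_num))
    hlt (Real.cos_le_one ϑ)
  rw [Real.arccos_cos h0 (by linarith)] at h2
  linarith

theorem principalAngle_le_arccos {L R : Submodule ℂ Φ} {c : ℝ}
    (h : ∀ v ∈ R, c * ‖v‖ ≤ ‖L.orthogonalProjectionOnto v‖) {j : ℕ} (hj : j < finrank ℂ R) :
    principalAngle L R j ≤ Real.arccos c :=
  Real.arccos_le_arccos (LinearMap.le_singularValues _ (fun v : R => h v v.2) hj)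

end Angles

/-! ### A hyperbolizer forces hyperbolicity and the angle bound. -/

section Necessity

variable {N : V →ₗ[ℝ] Φ →ₗ[ℂ] Ψ} {n : V} {h : V → (Ψ →ₗ[ℂ] Φ)}

theorem IsHyperbolizer.evolutionMatrix_apply (hh : IsHyperbolizer N n h) {k : V}
    (hk : k ∈ directions n) (v : Φ) : h k (N n (evolutionMatrix N n h k v)) = h k (N k v) := by
  have := Ring.mul_inverse_cancel_left _ (h k ∘ₗ N k : Module.End ℂ Φ) (hh.invertible k hk)
  exact LinearMap.congr_fun this v

theorem IsHyperbolizer.injective (hh : IsHyperbolizer N n h) {k : V}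
    (hk : k ∈ directions n) : Function.Injective fun v => h k (N n v) :=
  ((Module.End.isUnit_iff _).1 (hh.invertible k hk)).1

theorem IsHyperbolizer.evolutionMatrix_apply_of_mem (hh : IsHyperbolizer N n h) {k : V}
    (hk : k ∈ directions n) {lam : ℂ} {v : Φ} (hv : v ∈ rightKernel N n k lam) :
    evolutionMatrix N n h k v = lam • v := by
  apply hh.injective hk
  simp only [hh.evolutionMatrix_apply hk, mem_rightKernel_iff.1 hv, map_smul]

theorem IsHyperbolizer.isHyperbolic (hV : 2 ≤ finrank ℝ V) (hh : IsHyperbolizer N n h) :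
    IsHyperbolic N n := by
  constructor
  · obtain ⟨k, hk⟩ := directions_nonempty hV n
    rw [LinearMap.ker_eq_bot]
    exact fun x y hxy => hh.injective hk (congrArg (h k) hxy)
  · intro k hk lam hlam
    obtain ⟨v, hv, hv0⟩ := Submodule.exists_mem_ne_zero_of_ne_bot hlam
    exact hh.stronglyHyperbolic.1 k hk lam (Module.End.hasEigenvalue_of_hasEigenvector
      (Module.End.hasEigenvector_iff.2
        ⟨Module.End.mem_eigenspace_iff.2 (hh.evolutionMatrix_apply_of_mem hk hv), hv0⟩))

variable [FiniteDimensional ℂ Φ]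

/-- The projection of the right kernel to the projected left kernel is bounded below by the
condition number of a diagonalization of the reduced system. -/
theorem IsHyperbolizer.norm_le_mul_norm_orthogonalProjectionOnto (hh : IsHyperbolizer N n h)
    {k : V} (hk : k ∈ directions n) {S : EuclideanSpace ℂ (Fin (finrank ℂ Φ)) ≃L[ℂ] Φ}
    {d : Fin (finrank ℂ Φ) → ℂ} {C : ℝ}
    (hA : ∀ v : Φ, evolutionMatrix N n h k v = S (diagonalMap d (S.symm v)))
    (hC : ‖(S : EuclideanSpace ℂ (Fin (finrank ℂ Φ)) →L[ℂ] Φ)‖ *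
      ‖(S.symm : Φ →L[ℂ] EuclideanSpace ℂ (Fin (finrank ℂ Φ)))‖ ≤ C)
    {lam : ℂ} {v : Φ} (hv : v ∈ rightKernel N n k lam) :
    ‖v‖ ≤ C * ‖(projectedLeftKernel N n k lam).orthogonalProjectionOnto v‖ := by
  classical
  -- P is the spectral projection of A(k) for λ; the entries 0 and 1 of χ give it norm at most C.
  let χ : Fin (finrank ℂ Φ) → ℂ := fun i => if d i = lam then 1 else 0
  let P : Module.End ℂ Φ := S.toLinearMap ∘ₗ diagonalMap χ ∘ₗ S.symm.toLinearMap
  have hP : ∀ x, P x = S (diagonalMap χ (S.symm x)) := fun _ => rfl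
  have hdiag : ∀ (f : Fin (finrank ℂ Φ) → ℂ) x i, diagonalMap f x i = f i * x i := fun f x i => by
    simp [diagonalMap, Matrix.mulVec_diagonal]
  have hPA : ∀ x, P (evolutionMatrix N n h k x) = lam • P x := fun x => by
    rw [hP, hP, hA, S.symm_apply_apply, ← map_smul]
    congr 1
    ext i
    simp only [hdiag, PiLp.smul_apply, smul_eq_mul, χ]
    split_ifs with hi <;> simp [hi]
  have hPv : P v = v := by
    have h1 : diagonalMap χ (S.symm v) = S.symm v := by
      have h2 : diagonalMap d (S.symm v) = lam • S.symm v := by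
        rw [← S.symm_apply_apply (diagonalMap d (S.symm v)), ← hA,
          hh.evolutionMatrix_apply_of_mem hk hv, map_smul]
      ext i
      have h3 := congrArg (fun x => x i) h2
      simp only [hdiag, PiLp.smul_apply, smul_eq_mul] at h3
      rw [hdiag]
      simp only [χ]
      split_ifs with hi
      · simp
      · have : (d i - lam) * S.symm v i = 0 := by rw [sub_mul, h3, sub_self]
        rw [(mul_eq_zero.1 this).resolve_left (sub_ne_zero.2 hi), mul_zero]
    rw [hP, h1, S.apply_symm_apply]
  have hPbound : ∀ x, ‖P x‖ ≤ C * ‖x‖ := fun x => by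
    have h1 : ‖diagonalMap χ (S.symm x)‖ ≤ ‖S.symm x‖ := by
      rw [EuclideanSpace.norm_eq, EuclideanSpace.norm_eq]
      gcongr with i
      rw [hdiag]
      simp only [χ]
      split_ifs <;> simp
    calc ‖P x‖ ≤ ‖(S : EuclideanSpace ℂ (Fin (finrank ℂ Φ)) →L[ℂ] Φ)‖ *
          ‖diagonalMap χ (S.symm x)‖ :=
            (S : EuclideanSpace ℂ (Fin (finrank ℂ Φ)) →L[ℂ] Φ).le_opNorm _
      _ ≤ ‖(S : EuclideanSpace ℂ (Fin (finrank ℂ Φ)) →L[ℂ] Φ)‖ *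
          (‖(S.symm : Φ →L[ℂ] EuclideanSpace ℂ (Fin (finrank ℂ Φ)))‖ * ‖x‖) := by
            gcongr
            exact h1.trans
              ((S.symm : Φ →L[ℂ] EuclideanSpace ℂ (Fin (finrank ℂ Φ))).le_opNorm _)
      _ ≤ C * ‖x‖ := by rw [← mul_assoc]; gcongr
  set w := LinearMap.adjoint P v with hw
  have hwL : w ∈ projectedLeftKernel N n k lam := by
    -- The covector is X = ⟪v, P (h(k)N(n))⁻¹ h(k) ·⟫. It annihilates the symbol because PA = λP,
    -- and X ∘ N(n) = ⟪v, P ·⟫ = ⟪w, ·⟫.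
    refine ⟨(innerSL ℂ v).toLinearMap ∘ₗ P ∘ₗ Ring.inverse (h k ∘ₗ N n : Module.End ℂ Φ) ∘ₗ h k,
      mem_leftKernel_iff.2 fun x => ?_, fun x => ?_⟩
    · have h1 : Ring.inverse (h k ∘ₗ N n : Module.End ℂ Φ) (h k (N n x)) = x :=
        LinearMap.congr_fun (Ring.inverse_mul_cancel _ (hh.invertible k hk)) x
      have h2 : Ring.inverse (h k ∘ₗ N n : Module.End ℂ Φ) (h k (N k x)) =
        evolutionMatrix N n h k x := rfl
      simp only [LinearMap.comp_apply, h1, h2, hPA, map_smul, smul_eq_mul]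
    · have h1 : Ring.inverse (h k ∘ₗ N n : Module.End ℂ Φ) (h k (N n x)) = x :=
        LinearMap.congr_fun (Ring.inverse_mul_cancel _ (hh.invertible k hk)) x
      simp only [LinearMap.comp_apply, h1, hw, LinearMap.adjoint_inner_left]
      simp
  have hwv : ‖v‖ ^ 2 ≤ ‖w‖ * ‖(projectedLeftKernel N n k lam).orthogonalProjectionOnto v‖ := by
    have h1 : (inner ℂ w v : ℂ) = ((‖v‖ ^ 2 : ℝ) : ℂ) := by
      rw [hw, LinearMap.adjoint_inner_left, hPv, inner_self_eq_norm_sq_to_K]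
      norm_cast
    have h2 := Submodule.inner_orthogonalProjectionOnto_eq_of_mem_left
      (K := projectedLeftKernel N n k lam) ⟨w, hwL⟩ v
    have h3 := norm_inner_le_norm (𝕜 := ℂ) (⟨w, hwL⟩ : projectedLeftKernel N n k lam)
      ((projectedLeftKernel N n k lam).orthogonalProjectionOnto v)
    rw [h2] at h3
    simp only [h1] at h3
    simpa using h3
  have hwn : ‖w‖ ≤ C * ‖v‖ := by
    have h1 : (inner ℂ w w : ℂ) = inner ℂ v (P w) := by
      conv_lhs => rw [hw]
      rw [LinearMap.adjoint_inner_left]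
    have h2 : ‖w‖ ^ 2 ≤ ‖v‖ * (C * ‖w‖) := by
      calc ‖w‖ ^ 2 = ‖(inner ℂ w w : ℂ)‖ := by rw [inner_self_eq_norm_sq_to_K]; simp
        _ ≤ ‖v‖ * ‖P w‖ := by rw [h1]; exact norm_inner_le_norm _ _
        _ ≤ _ := by gcongr; exact hPbound w
    rcases (norm_nonneg w).eq_or_lt with h3 | h3
    · rw [← h3]
      have : 0 ≤ C := hC.trans' (by positivity)
      positivity
    · nlinarith
  rcases (norm_nonneg v).eq_or_lt with h3 | h3
  · rw [← h3]
    have : 0 ≤ C := hC.trans' (by positivity)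
    positivity
  · have h4 := mul_le_mul_of_nonneg_right hwn
      (norm_nonneg ((projectedLeftKernel N n k lam).orthogonalProjectionOnto v))
    nlinarith

theorem IsHyperbolizer.hasUniformAngleBound (hh : IsHyperbolizer N n h) :
    HasUniformAngleBound N n := by
  obtain ⟨-, C, hC, hS⟩ := hh.stronglyHyperbolic
  refine ⟨Real.arccos C⁻¹, Real.arccos_lt_pi_div_two.2 (inv_pos.2 hC), fun k hk lam _ j hj => ?_⟩
  obtain ⟨S, d, hA, hSC⟩ := hS k hk
  refine principalAngle_le_arccos (fun v hv => ?_) (hj.trans_le (min_le_right _ _))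
  rw [inv_mul_le_iff₀ hC]
  exact hh.norm_le_mul_norm_orthogonalProjectionOnto hk hA hSC hv

end Necessity

/-! ### Construction of a hyperbolizer for a complete system. -/

section Sufficiency

/-- The fields `φ` for which `N(k) φ` lies in the range of `N(n)`, so that the system determines
the transversal derivative of the plane wave with amplitude `φ`. -/
def determinedFields (N : V →ₗ[ℝ] Φ →ₗ[ℂ] Ψ) (n k : V) : Submodule ℂ Φ :=
  (LinearMap.range (N n)).comap (N k)

variable {N : V →ₗ[ℝ] Φ →ₗ[ℂ] Ψ} {n k : V}

theorem IsConstraint.apply_apply_add {c : V →ₗ[ℝ] Dual ℂ Ψ} (hc : IsConstraint N c) (k l : V)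
    (v : Φ) : c k (N l v) + c l (N k v) = 0 := by
  have h1 := LinearMap.congr_fun (hc (k + l)) v
  have h2 := LinearMap.congr_fun (hc k) v
  have h3 := LinearMap.congr_fun (hc l) v
  simp only [LinearMap.comp_apply, map_add, LinearMap.add_apply, LinearMap.zero_apply] at h1 h2 h3
  linear_combination h1 - h2 - h3

/-- The covectors c(n) always annihilate the range of N(n), whose annihilator has dimension e - u;
completeness says that they fill it. -/
theorem IsComplete.exists_constraint [FiniteDimensional ℂ Ψ] (hc : IsComplete N n)
    (hn : LinearMap.ker (N n) = ⊥) {X : Dual ℂ Ψ} (hX : ∀ v, X (N n v) = 0) :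
    ∃ c, IsConstraint N c ∧ c n = X := by
  have hle : constraintCombinations N n ≤ (LinearMap.range (N n)).dualAnnihilator := by
    rintro _ ⟨c, hc, rfl⟩
    rw [Submodule.mem_dualAnnihilator]
    rintro _ ⟨v, rfl⟩
    exact LinearMap.congr_fun (hc n) v
  have h1 := Subspace.finrank_add_finrank_dualAnnihilator_eq (LinearMap.range (N n))
  rw [LinearMap.finrank_range_of_inj (LinearMap.ker_eq_bot.1 hn), hc] at h1
  have heq := Submodule.eq_of_le_of_finrank_eq hle (by omega)
  have hmem : X ∈ (LinearMap.range (N n)).dualAnnihilator := by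
    rw [Submodule.mem_dualAnnihilator]
    rintro _ ⟨v, rfl⟩
    exact hX v
  rw [← heq] at hmem
  exact hmem

/-- Completeness makes the determined fields invariant. -/
theorem IsComplete.mem_determinedFields [FiniteDimensional ℂ Ψ] (hc : IsComplete N n)
    (hn : LinearMap.ker (N n) = ⊥) {a b : Φ} (hab : N n a = N k b) :
    a ∈ determinedFields N n k := by
  change N k a ∈ LinearMap.range (N n)
  refine mem_of_forall_dual fun X hX => ?_
  -- For X = c(n), polarization gives c(n)N(k)a = -c(k)N(n)a = -c(k)N(k)b = 0.
  obtain ⟨c, hc, rfl⟩ := hc.exists_constraint hn fun v => hX _ ⟨v, rfl⟩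
  have h1 := hc.apply_apply_add k n a
  have h2 : c k (N k b) = 0 := LinearMap.congr_fun (hc k) b
  rwa [hab, h2, zero_add] at h1

theorem rightKernel_le_determinedFields (lam : ℂ) :
    rightKernel N n k lam ≤ determinedFields N n k := fun v hv =>
  ⟨lam • v, by rw [map_smul, mem_rightKernel_iff.1 hv]⟩

/-- A reduction that completes the evolution of the determined fields by zero. -/
theorem exists_leftInverse_vanishing_on_orthogonal (hn : LinearMap.ker (N n) = ⊥) (k : V) :
    ∃ g : Ψ →ₗ[ℂ] Φ, (∀ a, g (N n a) = a) ∧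
      ∀ y ∈ (determinedFields N n k)ᗮ, g (N k y) = 0 := by
  -- T is injective: if N(n)a + N(k)y = 0, then y is determined and orthogonal to the determined
  -- fields, hence zero. The first component of a left inverse of T is the required g.
  let T : Φ × (determinedFields N n k)ᗮ →ₗ[ℂ] Ψ :=
    (N n).coprod (N k ∘ₗ (determinedFields N n k)ᗮ.subtype)
  have hT : ∀ a y, T (a, y) = N n a + N k y := fun a y => by simp [T]
  have hker : LinearMap.ker T = ⊥ := by
    rw [LinearMap.ker_eq_bot']
    rintro ⟨a, y⟩ hay
    rw [hT] at hay
    have hy : (y : Φ) ∈ determinedFields N n k :=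
      ⟨-a, by rw [map_neg, neg_eq_iff_add_eq_zero, hay]⟩
    have hy0 : (y : Φ) = 0 := by
      rw [← Submodule.mem_bot ℂ, ← (determinedFields N n k).inf_orthogonal_eq_bot]
      exact ⟨hy, y.2⟩
    rw [hy0, map_zero, add_zero] at hay
    have ha : a = 0 := LinearMap.ker_eq_bot'.1 hn a hay
    exact Prod.ext ha (Subtype.ext hy0)
  obtain ⟨G, hG⟩ := LinearMap.exists_leftInverse_of_injective T hker
  refine ⟨LinearMap.fst ℂ _ _ ∘ₗ G, fun a => ?_, fun y hy => ?_⟩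
  · have h1 := LinearMap.congr_fun hG (a, 0)
    rw [LinearMap.comp_apply, hT] at h1
    simp only [ZeroMemClass.coe_zero, map_zero, add_zero, LinearMap.id_apply] at h1
    rw [LinearMap.comp_apply, h1, LinearMap.fst_apply]
  · have h1 := LinearMap.congr_fun hG (0, ⟨y, hy⟩)
    rw [LinearMap.comp_apply, hT] at h1
    simp only [map_zero, zero_add, LinearMap.id_apply] at h1
    rw [LinearMap.comp_apply, h1, LinearMap.fst_apply]

variable {g : Ψ →ₗ[ℂ] Φ}

theorem mem_rightKernel_of_apply_eq (hg : ∀ a, g (N n a) = a) {x : Φ} {mu : ℂ}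
    (hx : x ∈ determinedFields N n k) (h : g (N k x) = mu • x) : x ∈ rightKernel N n k mu := by
  obtain ⟨a, ha⟩ := hx
  rw [← ha, hg] at h
  rw [mem_rightKernel_iff, ← ha, h, map_smul]

theorem apply_eq_of_mem_determinedFields (hg : ∀ a, g (N n a) = a) {x : Φ}
    (hx : x ∈ determinedFields N n k) : N n (g (N k x)) = N k x := by
  obtain ⟨a, ha⟩ := hx
  rw [← ha, hg]

theorem eq_zero_of_eq_mem_orthogonal {F : Submodule ℂ Φ} {x y : Φ} (hx : x ∈ F) (hy : y ∈ Fᗮ)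
    (h : x = y) : x = 0 := by
  rw [← Submodule.mem_bot ℂ, ← F.inf_orthogonal_eq_bot]
  exact ⟨hx, h ▸ hy⟩

/-- The determined components of an eigenvector of the reduced system form an eigenvector of the
full system, unless they vanish. -/
theorem eigenvector_components [FiniteDimensional ℂ Ψ] (hc : IsComplete N n)
    (hn : LinearMap.ker (N n) = ⊥) (hg : ∀ a, g (N n a) = a)
    (hg' : ∀ y ∈ (determinedFields N n k)ᗮ, g (N k y) = 0) {mu : ℂ} {x y : Φ}
    (hx : x ∈ determinedFields N n k) (hy : y ∈ (determinedFields N n k)ᗮ)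
    (h : g (N k (x + y)) = mu • (x + y)) : x ∈ rightKernel N n k mu ∧ mu • y = 0 := by
  rw [map_add, map_add, hg' y hy, add_zero, smul_add] at h
  have hxy : g (N k x) - mu • x = mu • y := by rw [h]; abel
  -- By invariance the left side of `hxy` is in F, while the right side is in Fᗮ; so both vanish.
  have h0 := eq_zero_of_eq_mem_orthogonal
    (Submodule.sub_mem _ (hc.mem_determinedFields hn (apply_eq_of_mem_determinedFields hg hx))
      (Submodule.smul_mem _ mu hx)) (Submodule.smul_mem _ mu hy) hxy
  exact ⟨mem_rightKernel_of_apply_eq hg hx (sub_eq_zero.1 h0), hxy ▸ h0⟩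

variable [FiniteDimensional ℂ Φ]

theorem exists_add_eq_of_orthogonal (F : Submodule ℂ Φ) (v : Φ) :
    ∃ x ∈ F, ∃ y ∈ Fᗮ, x + y = v :=
  Submodule.mem_sup.1 (F.sup_orthogonal_of_hasOrthogonalProjection ▸ Submodule.mem_top)

/-- The summands that diagonalize the reduced system. -/
noncomputable def reducedEigenspace (N : V →ₗ[ℝ] Φ →ₗ[ℂ] Ψ) (n k : V) : Option ℂ → Submodule ℂ Φ
  | none => (determinedFields N n k)ᗮ
  | some mu => rightKernel N n k mu

theorem iSup_reducedEigenspace_eq_top [FiniteDimensional ℂ Ψ] (hc : IsComplete N n)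
    (hn : LinearMap.ker (N n) = ⊥) (hg : ∀ a, g (N n a) = a)
    (hg' : ∀ y ∈ (determinedFields N n k)ᗮ, g (N k y) = 0) {c : ℝ} (hc0 : 0 < c)
    (hproj : ∀ mu, ∀ v ∈ rightKernel N n k mu,
      c * ‖v‖ ≤ ‖(projectedLeftKernel N n k mu).orthogonalProjectionOnto v‖) :
    ⨆ i, reducedEigenspace N n k i = ⊤ := by
  have hspan : ⨆ mu, Module.End.eigenspace (g ∘ₗ N k) mu = ⊤ := by
    refine Module.End.iSup_eigenspace_eq_top_of_apply_apply _ fun mu v hv => ?_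
    obtain ⟨x, hx, y, hy, rfl⟩ := exists_add_eq_of_orthogonal (determinedFields N n k) v
    simp only [LinearMap.comp_apply] at hv ⊢
    have hsplit : g (N k (x + y)) - mu • (x + y) = (g (N k x) - mu • x) + -(mu • y) := by
      rw [map_add, map_add, hg' y hy, smul_add]; abel
    rw [hsplit] at hv
    have hz := Submodule.sub_mem _
      (hc.mem_determinedFields hn (apply_eq_of_mem_determinedFields hg hx))
      (Submodule.smul_mem _ mu hx)
    obtain ⟨hzR, hy0⟩ := eigenvector_components hc hn hg hg' hz
      (Submodule.neg_mem _ (Submodule.smul_mem _ mu hy)) hv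
    -- For z = g(N(k)x) - μx one has N(n)z = (N(k) - μN(n))x, in the range of the symbol. As z is
    -- also in the right kernel, the projection bound leaves only z = 0.
    have hzL : g (N k x) - mu • x ∈ (projectedLeftKernel N n k mu)ᗮ :=
      mem_orthogonal_of_apply_eq (u := x) (by
        rw [map_sub, map_smul, apply_eq_of_mem_determinedFields hg hx])
    have hz0 : g (N k x) - mu • x = 0 := by
      have h1 := hproj mu _ hzR
      rw [Submodule.orthogonalProjectionOnto_eq_zero_iff.2 hzL, norm_zero] at h1
      exact norm_le_zero_iff.1 (nonpos_of_mul_nonpos_right h1 hc0)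
    have hmuy : mu • y = 0 := by
      rcases eq_or_ne mu 0 with rfl | h
      · exact zero_smul _ _
      · exact neg_eq_zero.1 ((smul_eq_zero.1 hy0).resolve_left h)
    rw [← sub_eq_zero, hsplit, hz0, hmuy, neg_zero, add_zero]
  rw [eq_top_iff, ← hspan]
  refine iSup_le fun mu v hv => ?_
  obtain ⟨x, hx, y, hy, rfl⟩ := exists_add_eq_of_orthogonal (determinedFields N n k) v
  obtain ⟨hxR, -⟩ := eigenvector_components hc hn hg hg' hx hy (Module.End.mem_eigenspace_iff.1 hv)
  exact Submodule.add_mem _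
    (le_iSup (reducedEigenspace N n k) (some mu) hxR) (le_iSup (reducedEigenspace N n k) none hy)

theorem reducedEigenspace_separated {c : ℝ} (hc0 : 0 < c) (hc1 : c ≤ 1)
    (hproj : ∀ mu, ∀ v ∈ rightKernel N n k mu,
      c * ‖v‖ ≤ ‖(projectedLeftKernel N n k mu).orthogonalProjectionOnto v‖) (i : Option ℂ) (v : Φ)
    (hv : v ∈ reducedEigenspace N n k i) (w : Φ)
    (hw : w ∈ ⨆ (j) (_ : j ≠ i), reducedEigenspace N n k j) : ‖v‖ ≤ c⁻¹ * ‖v + w‖ := by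
  rw [← div_eq_inv_mul, le_div_iff₀' hc0]
  cases i with
  | none =>
    have hwF : w ∈ determinedFields N n k := by
      refine (iSup₂_le fun j hj => ?_ : _ ≤ determinedFields N n k) hw
      cases j with
      | none => exact absurd rfl hj
      | some mu => exact rightKernel_le_determinedFields mu
    have h1 := norm_add_sq_eq_norm_sq_add_norm_sq_of_inner_eq_zero (𝕜 := ℂ) v w
      (Submodule.inner_left_of_mem_orthogonal hwF hv)
    have h2 : ‖v‖ ≤ ‖v + w‖ := by
      nlinarith [norm_nonneg v, norm_nonneg w, norm_nonneg (v + w)]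
    exact (mul_le_of_le_one_left (norm_nonneg v) hc1).trans h2
  | some mu =>
    -- The projection to F comes first because Fᗮ need not be orthogonal to the projected left
    -- kernel. T thus kills every summand other than that of μ, and does not increase norms.
    let T : Φ →ₗ[ℂ] projectedLeftKernel N n k mu :=
      (projectedLeftKernel N n k mu).orthogonalProjectionOnto.toLinearMap ∘ₗ
        (determinedFields N n k).starProjection.toLinearMap
    have hT : ∀ x, T x = (projectedLeftKernel N n k mu).orthogonalProjectionOnto
      ((determinedFields N n k).starProjection x) := fun _ => rfl
    have hTF : ∀ x ∈ determinedFields N n k,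
        T x = (projectedLeftKernel N n k mu).orthogonalProjectionOnto x := fun x hx => by
      rw [hT, Submodule.starProjection_eq_self_iff.2 hx]
    have hTw : T w = 0 := by
      refine (iSup₂_le fun j hj x hx => ?_ : _ ≤ LinearMap.ker T) hw
      cases j with
      | none =>
        rw [LinearMap.mem_ker, hT, (Submodule.starProjection_apply_eq_zero_iff _).2 hx, map_zero]
      | some nu =>
        rw [LinearMap.mem_ker, hTF x (rightKernel_le_determinedFields nu hx)]
        exact Submodule.orthogonalProjectionOnto_eq_zero_iff.2
          (rightKernel_le_orthogonal (fun h => hj (congrArg some h)) hx)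
    calc c * ‖v‖ ≤ ‖T (v + w)‖ := by
          rw [map_add, hTw, add_zero, hTF v (rightKernel_le_determinedFields mu hv)]
          exact hproj mu v hv
      _ ≤ ‖v + w‖ := by
          rw [hT]
          exact (Submodule.norm_orthogonalProjectionOnto_apply_le _ _).trans
            (Submodule.norm_starProjection_apply_le _ _)

/-- A nonzero v makes μ a generalized eigenvalue, so the angle bound applies; for v = 0 nothing is
needed, and the estimate holds at all μ. -/
theorem exists_bound_of_hasUniformAngleBound [FiniteDimensional ℂ Ψ]
    (hn : LinearMap.ker (N n) = ⊥) (h : HasUniformAngleBound N n) :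
    ∃ c : ℝ, 0 < c ∧ c ≤ 1 ∧ ∀ k ∈ directions n, ∀ mu, ∀ v ∈ rightKernel N n k mu,
      c * ‖v‖ ≤ ‖(projectedLeftKernel N n k mu).orthogonalProjectionOnto v‖ := by
  obtain ⟨ϑ, hϑ, h⟩ := h
  have hpos := Real.pi_pos
  -- The bound ϑ may be negative; replacing it by max ϑ 0 keeps the cosine positive.
  refine ⟨Real.cos (max ϑ 0), Real.cos_pos_of_mem_Ioo ⟨?_, max_lt hϑ (by positivity)⟩,
    Real.cos_le_one _, fun k hk mu v hv => ?_⟩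
  · linarith [le_max_right ϑ 0]
  rcases eq_or_ne v 0 with rfl | hv0
  · simp
  refine mul_norm_le_of_principalAngle_le (le_max_right _ _) (max_lt hϑ (by positivity))
    (fun j hj => (h k hk mu (fun hbot => hv0 ?_) j (lt_min ?_ hj)).trans (le_max_left _ _)) hv
  · rwa [hbot, Submodule.mem_bot] at hv
  · exact hj.trans_le (finrank_rightKernel_le hn mu)

theorem IsComplete.admitsHyperbolizer [FiniteDimensional ℂ Ψ] (hc : IsComplete N n)
    (hN : IsHyperbolic N n) (hangle : HasUniformAngleBound N n) : AdmitsHyperbolizer N n := by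
  obtain ⟨hn, hreal⟩ := hN
  obtain ⟨c, hc0, hc1, hproj⟩ := exists_bound_of_hasUniformAngleBound hn hangle
  choose g hg hg' using exists_leftInverse_vanishing_on_orthogonal (N := N) hn
  -- Evaluating the pointwise choice g on the unit sphere makes it homogeneous of degree 0.
  let h : V → (Ψ →ₗ[ℂ] Φ) := fun k => g (‖k‖⁻¹ • k)
  have hh : ∀ k ∈ directions n, h k = g k := fun k hk => by simp [h, hk.2]
  have hunit : ∀ k ∈ directions n, (h k ∘ₗ N n : Module.End ℂ Φ) = 1 := fun k hk => by
    ext v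
    simp [hh k hk, hg]
  have hA : ∀ k ∈ directions n, ∀ v, evolutionMatrix N n h k v = g k (N k v) := fun k hk v => by
    rw [evolutionMatrix, hunit k hk, Ring.inverse_one, one_mul, LinearMap.comp_apply, hh k hk]
  refine ⟨h, fun r k hr => ?_, fun k hk => hunit k hk ▸ isUnit_one, fun k hk τ hτ => ?_,
    -- The summand 1 keeps the constant positive when Φ = 0.
    finrank ℂ Φ * (finrank ℂ Φ * c⁻¹) + 1, by positivity, fun k hk => ?_⟩
  · simp only [h, norm_smul, Real.norm_of_nonneg hr.le, mul_inv, smul_smul]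
    rw [mul_right_comm, inv_mul_cancel₀ hr.ne', one_mul]
  · obtain ⟨v, hv⟩ := hτ.exists_hasEigenvector
    have hv' := hv.apply_eq_smul
    rw [hA k hk] at hv'
    obtain ⟨x, hx, y, hy, rfl⟩ := exists_add_eq_of_orthogonal (determinedFields N n k) v
    obtain ⟨hxR, hy0⟩ := eigenvector_components hc hn (hg k) (hg' k) hx hy hv'
    -- The reduction adds only the eigenvalue 0, on Fᗮ; a nonzero one has its eigenvector in F and
    -- is a generalized eigenvalue.
    rcases eq_or_ne τ 0 with rfl | hτ0
    · rfl
    · refine hreal k hk τ fun hbot => hv.2 ?_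
      rw [hbot, Submodule.mem_bot] at hxR
      rw [hxR, (smul_eq_zero.1 hy0).resolve_left hτ0, add_zero]
  · have hE : ∀ i, ∀ v ∈ reducedEigenspace N n k i,
        evolutionMatrix N n h k v = i.getD 0 • v := fun i v hv => by
      rw [hA k hk]
      cases i with
      | none => simpa using hg' k v hv
      | some mu =>
        rw [mem_rightKernel_iff.1 hv, map_smul, hg]
        rfl
    obtain ⟨S, d, hS, hSC⟩ := Module.End.exists_diagonalMap_of_separated (inv_nonneg.2 hc0.le)
      (iSup_reducedEigenspace_eq_top hc hn (hg k) (hg' k) hc0 (hproj k hk)) hE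
      (reducedEigenspace_separated hc0 hc1 (hproj k hk))
    exact ⟨S, d, hS, hSC.trans (by linarith)⟩

end Sufficiency

end FirstOrderSystem

theorem theorem2 {V Φ Ψ : Type*}
    [NormedAddCommGroup V] [NormedSpace ℝ V] [FiniteDimensional ℝ V]
    [NormedAddCommGroup Φ] [InnerProductSpace ℂ Φ] [FiniteDimensional ℂ Φ]
    [AddCommGroup Ψ] [Module ℂ Ψ] [FiniteDimensional ℂ Ψ]
    (hV : 2 ≤ Module.finrank ℝ V)
    (N : V →ₗ[ℝ] Φ →ₗ[ℂ] Ψ) (n : V) :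
    (FirstOrderSystem.AdmitsHyperbolizer N n →
      FirstOrderSystem.IsHyperbolic N n ∧ FirstOrderSystem.HasUniformAngleBound N n) ∧
    (FirstOrderSystem.IsComplete N n →
      (FirstOrderSystem.AdmitsHyperbolizer N n ↔
        FirstOrderSystem.IsHyperbolic N n ∧ FirstOrderSystem.HasUniformAngleBound N n)) := by
  have hnec : FirstOrderSystem.AdmitsHyperbolizer N n →
      FirstOrderSystem.IsHyperbolic N n ∧ FirstOrderSystem.HasUniformAngleBound N n :=
    fun ⟨_, hh⟩ => ⟨hh.isHyperbolic hV, hh.hasUniformAngleBound⟩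
  exact ⟨hnec, fun hc => ⟨hnec, fun h => hc.admitsHyperbolizer h.1 h.2⟩⟩
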